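/- Let $\mathbb{C}$ be a regular category, i.e. a category with finite limits in which every morphism factors as a regular epimorphism followed by a monomorphism and regular epimorphisms are stable under pullback. A relation $R$ on an object $X$ is a subobject $\langle r_1,r_2\rangle\colon R\rightarrowtail X\times X$; $1_X$ is the relation $\langle 1_X,1_X\rangle$, $R^\circ$ is the relation $\langle r_2,r_1\rangle$, and $RR$ is the monomorphic part of the (regular epimorphism, monomorphism) factorization of $\langle r_1\pi_1,r_2\pi_2\rangle\colon R\times_X R\to X\times X$, where $\pi_1,\pi_2$ are the projections of the pullback of $r_2$ and $r_1$. The relation $R$ is reflexive if $1_X\leqslant R$, symmetric if $R^\circ\leqslant R$, transitive if $RR\leqslant R$, and an equivalence relation if it has all three properties. For generalised elements $x,y\colon A\to X$ one writes $(x,y)\in R$ if $\langle x,y\rangle\colon A\to X\times X$ factors through $R$. The category $\mathbb{C}$ is a Mal'tsev category if every reflexive relation in $\mathbb{C}$ is an equivalence relation. The following conditions are equivalent: (i) $\mathbb{C}$ is a Mal'tsev category; (ii) the Shifting Lemma holds in $\mathbb{C}$ when $R$ and $T$ are reflexive relations and $S$ is an equivalence relation, that is: for every object $X$ of $\mathbb{C}$,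 all reflexive relations $R$, $T$ on $X$ and every equivalence relation $S$ on $X$ with $R\wedge S\leqslant T$, and for all objects $A$ and all generalised elements $x,y,u,v\colon A\to X$ with $(x,y)\in R\wedge T$, $(x,u)\in S$, $(y,v)\in S$ and $(u,v)\in R$, one has $(u,v)\in T$. -/

import Mathlib

open CategoryTheory Limits

universe v u

namespace InternalRelation

variable {C : Type u} [Category.{v} C] [Regular C]

/-- An internal relation from `X` to `Y` is a subobject of `X ⨯ Y`. -/
abbrev Rel (X Y : C) : Type (max u v) := Subobject (X ⨯ Y)

/-- The first leg `r₁` of a relation `⟨r₁, r₂⟩ : R ↣ X ⨯ Y`. -/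
noncomputable abbrev leg₁ {X Y : C} (R : Rel X Y) : (R : C) ⟶ X := R.arrow ≫ prod.fst

/-- The second leg `r₂` of a relation `⟨r₁, r₂⟩ : R ↣ X ⨯ Y`. -/
noncomputable abbrev leg₂ {X Y : C} (R : Rel X Y) : (R : C) ⟶ Y := R.arrow ≫ prod.snd

theorem legs_ext {X Y A : C} (R : Rel X Y) {f g : A ⟶ (R : C)}
    (h₁ : f ≫ leg₁ R = g ≫ leg₁ R) (h₂ : f ≫ leg₂ R = g ≫ leg₂ R) : f = g := by
  rw [← cancel_mono R.arrow]
  ext <;> simpa using by assumption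

instance {X Y : C} (R : Rel X Y) : Mono (prod.lift (leg₂ R) (leg₁ R)) where
  right_cancellation f g h := by
    have h₁ := congrArg (· ≫ prod.fst) h
    have h₂ := congrArg (· ≫ prod.snd) h
    simp only [Category.assoc, prod.lift_fst, prod.lift_snd] at h₁ h₂
    exact legs_ext R (by simpa using h₂) (by simpa using h₁)

/-- The identity relation `⟨1, 1⟩ : X ↣ X ⨯ X`. -/
noncomputable def idRel (X : C) : Rel X X := Subobject.mk (prod.lift (𝟙 X) (𝟙 X))

/-- The opposite relation, the subobject `⟨r₂, r₁⟩ : R ↣ Y ⨯ X`. -/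
noncomputable def opp {X Y : C} (R : Rel X Y) : Rel Y X :=
  Subobject.mk (prod.lift (leg₂ R) (leg₁ R))

/-- The composite (first `R`, then `S`): the image of `⟨r₁ π₁, s₂ π₂⟩` defined on the pullback of
`r₂` and `s₁`. In a regular category the image is the monomorphic part of the (regular epimorphism,
monomorphism) factorization. -/
noncomputable def comp {X Y Z : C} (R : Rel X Y) (S : Rel Y Z) : Rel X Z :=
  imageSubobject (prod.lift (pullback.fst (leg₂ R) (leg₁ S) ≫ leg₁ R)
    (pullback.snd (leg₂ R) (leg₁ S) ≫ leg₂ S))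

def IsReflexive {X : C} (R : Rel X X) : Prop := idRel X ≤ R

def IsSymmetric {X : C} (R : Rel X X) : Prop := opp R ≤ R

def IsTransitive {X : C} (R : Rel X X) : Prop := comp R R ≤ R

/-- Internal equivalence relations. -/
structure IsEquivalence {X : C} (R : Rel X X) : Prop where
  refl : IsReflexive R
  symm : IsSymmetric R
  trans : IsTransitive R

/-- `(x, y) ∈ R` for generalised elements `x : A ⟶ X` and `y : A ⟶ Y`: the morphism
`⟨x, y⟩ : A ⟶ X ⨯ Y` factors through the subobject `R`. -/
def Mem {X Y A : C} (x : A ⟶ X) (y : A ⟶ Y) (R : Rel X Y) : Prop :=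
  R.Factors (prod.lift x y)

/-- The Shifting Lemma for the relations `R`, `S`, `T` on `X`, read with generalised elements:
if `R ∧ S ≤ T`, then for all `x`, `y`, `u`, `v` with `(x, y) ∈ R ∧ T`, `(x, u) ∈ S`, `(y, v) ∈ S`
and `(u, v) ∈ R`, one has `(u, v) ∈ T`. -/
def ShiftingLemma {X : C} (R S T : Rel X X) : Prop :=
  R ⊓ S ≤ T → ∀ ⦃A : C⦄ (x y u v : A ⟶ X),
    Mem x y (R ⊓ T) → Mem x u S → Mem y v S → Mem u v R → Mem u v T

variable (C) in
/-- Every reflexive relation is an equivalence relation. -/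
def IsMaltsev : Prop :=
  ∀ ⦃X : C⦄ (R : Rel X X), IsReflexive R → IsEquivalence R

end InternalRelation

namespace InternalRelation

/-! ### Calculus of relations with generalised elements. -/

section Elements

variable {C : Type u} [Category.{v} C] [Regular C]

/-! If reflexive relations are equivalences, they also permute. From `u S x (R ∧ T) y` this gives
`w` with `u (R ∧ T) w S y`; then `w R u R v` and `w S y S v`, so `(w, v) ∈ R ∧ S ≤ T` and `u T w T
v`.

Conversely, a reflexive relation `E` on `X` is studied on the object `E` itself, whose elements are
related pairs. There `p₁ E q₂` and `q₁ E p₂` define reflexive relations, and `p₁ = q₁` is a kernel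
pair contained in both. The Shifting Lemma for these (`mem_of_shiftingLemma`) yields symmetry and
transitivity of `E` by two choices of pairs. Only kernel pairs are needed as `S`. -/

theorem Mem.mono {X Y A : C} {x : A ⟶ X} {y : A ⟶ Y} {R S : Rel X Y} (h : Mem x y R)
    (hRS : R ≤ S) : Mem x y S :=
  Subobject.factors_of_le _ hRS h

theorem Mem.precomp {X Y A B : C} {x : A ⟶ X} {y : A ⟶ Y} {R : Rel X Y} (h : Mem x y R)
    (f : B ⟶ A) : Mem (f ≫ x) (f ≫ y) R := by
  unfold Mem
  rw [← prod.comp_lift]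
  exact Subobject.factors_of_factors_right f h

theorem mem_inf_iff {X Y A : C} {x : A ⟶ X} {y : A ⟶ Y} {R S : Rel X Y} :
    Mem x y (R ⊓ S) ↔ Mem x y R ∧ Mem x y S :=
  Subobject.inf_factors _

theorem lift_legs {X Y : C} (R : Rel X Y) : prod.lift (leg₁ R) (leg₂ R) = R.arrow :=
  Limits.prod.hom_ext (prod.lift_fst _ _) (prod.lift_snd _ _)

theorem mem_legs {X Y : C} (R : Rel X Y) : Mem (leg₁ R) (leg₂ R) R := by
  unfold Mem
  rw [lift_legs]
  exact Subobject.factors_self R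

theorem mem_mk_iff {X Y A M : C} {x : A ⟶ X} {y : A ⟶ Y} {f : M ⟶ X} {g : M ⟶ Y}
    [Mono (prod.lift f g)] :
    Mem x y (Subobject.mk (prod.lift f g)) ↔ ∃ k : A ⟶ M, k ≫ f = x ∧ k ≫ g = y := by
  suffices key : ∀ k : A ⟶ M, k ≫ prod.lift f g = prod.lift x y ↔ k ≫ f = x ∧ k ≫ g = y from
    (Subobject.mk_factors_iff _ _).trans (exists_congr key)
  intro k
  rw [prod.comp_lift]
  constructor
  · intro h
    have h₁ := congrArg (· ≫ prod.fst) h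
    have h₂ := congrArg (· ≫ prod.snd) h
    simp only [prod.lift_fst, prod.lift_snd] at h₁ h₂
    exact ⟨h₁, h₂⟩
  · rintro ⟨rfl, rfl⟩
    rfl

theorem Mem.exists_hom {X Y A : C} {x : A ⟶ X} {y : A ⟶ Y} {R : Rel X Y} (h : Mem x y R) :
    ∃ f : A ⟶ (R : C), f ≫ leg₁ R = x ∧ f ≫ leg₂ R = y := by
  unfold Mem at h
  refine ⟨R.factorThru _ h, ?_, ?_⟩
  · rw [Subobject.factorThru_arrow_assoc, prod.lift_fst]
  · rw [Subobject.factorThru_arrow_assoc, prod.lift_snd]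

theorem le_iff_forall_mem {X Y : C} {R S : Rel X Y} :
    R ≤ S ↔ ∀ ⦃A : C⦄ (x : A ⟶ X) (y : A ⟶ Y), Mem x y R → Mem x y S := by
  refine ⟨fun h A x y hxy => hxy.mono h, fun h => Subobject.le_of_factors ?_⟩
  have h₁ := h _ _ (mem_legs R)
  unfold Mem at h₁
  rwa [lift_legs] at h₁

theorem mem_idRel_iff {X A : C} {x y : A ⟶ X} : Mem x y (idRel X) ↔ x = y :=
  mem_mk_iff.trans
    ⟨fun ⟨_, hx, hy⟩ => hx.symm.trans hy, fun h => ⟨x, Category.comp_id x, h ▸ Category.comp_id x⟩⟩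

theorem mem_opp_iff {X Y A : C} {x : A ⟶ X} {y : A ⟶ Y} {R : Rel X Y} :
    Mem y x (opp R) ↔ Mem x y R := by
  refine mem_mk_iff.trans ⟨?_, fun h => ?_⟩
  · rintro ⟨k, rfl, rfl⟩
    exact (mem_legs R).precomp k
  · obtain ⟨f, hx, hy⟩ := h.exists_hom
    exact ⟨f, hy, hx⟩

theorem mem_comp {X Y Z A : C} {x : A ⟶ X} {y : A ⟶ Y} {z : A ⟶ Z} {R : Rel X Y} {S : Rel Y Z}
    (hR : Mem x y R) (hS : Mem y z S) : Mem x z (comp R S) := by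
  obtain ⟨f, rfl, hf⟩ := hR.exists_hom
  obtain ⟨g, hg, rfl⟩ := hS.exists_hom
  have h := imageSubobject_factors_comp_self
    (f := prod.lift (pullback.fst (leg₂ R) (leg₁ S) ≫ leg₁ R)
      (pullback.snd (leg₂ R) (leg₁ S) ≫ leg₂ S))
    (pullback.lift f g (hf.trans hg.symm))
  rwa [prod.comp_lift, pullback.lift_fst_assoc, pullback.lift_snd_assoc] at h

/-- Membership in a composite is witnessed by a middle element after a regular epimorphism. -/
theorem Mem.exists_of_comp {X Y Z A : C} {x : A ⟶ X} {z : A ⟶ Z} {R : Rel X Y} {S : Rel Y Z}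
    (h : Mem x z (comp R S)) :
    ∃ (B : C) (e : B ⟶ A) (_ : IsRegularEpi e) (y : B ⟶ Y),
      Mem (e ≫ x) y R ∧ Mem y (e ≫ z) S := by
  let p := prod.lift (pullback.fst (leg₂ R) (leg₁ S) ≫ leg₁ R)
    (pullback.snd (leg₂ R) (leg₁ S) ≫ leg₂ S)
  -- Strong epimorphisms are regular in a regular category, so the pullback `e` below is again a
  -- regular epimorphism.
  have : StrongEpi (factorThruImageSubobject p) := by
    unfold factorThruImageSubobject
    infer_instance
  let f := (imageSubobject p).factorThru _ h
  have hf : f ≫ (imageSubobject p).arrow = prod.lift x z := Subobject.factorThru_arrow _ _ h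
  let e := pullback.fst f (factorThruImageSubobject p)
  let g := pullback.snd f (factorThruImageSubobject p)
  have hfac : prod.lift (e ≫ x) (e ≫ z) = g ≫ p := by
    rw [← prod.comp_lift, ← hf, ← Category.assoc, pullback.condition, Category.assoc,
      imageSubobject_arrow_comp]
  have hx : e ≫ x = g ≫ pullback.fst (leg₂ R) (leg₁ S) ≫ leg₁ R := by
    simpa only [p, prod.comp_lift, prod.lift_fst] using congrArg (· ≫ prod.fst) hfac
  have hz : e ≫ z = g ≫ pullback.snd (leg₂ R) (leg₁ S) ≫ leg₂ S := by
    simpa only [p, prod.comp_lift, prod.lift_snd] using congrArg (· ≫ prod.snd) hfac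
  refine ⟨_, e, inferInstance, g ≫ pullback.fst (leg₂ R) (leg₁ S) ≫ leg₂ R, ?_, ?_⟩
  · rw [hx]
    exact ((mem_legs R).precomp _).precomp _
  · rw [hz, pullback.condition]
    exact ((mem_legs S).precomp _).precomp _

/-- A strong epimorphism lifts against the mono `R.arrow`. Hence witnesses that exist only after a
regular epimorphism suffice to prove membership. -/
theorem Mem.of_precomp {X Y A B : C} {x : A ⟶ X} {y : A ⟶ Y} {R : Rel X Y} (e : B ⟶ A)
    [StrongEpi e] (h : Mem (e ≫ x) (e ≫ y) R) : Mem x y R := by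
  unfold Mem at h
  rw [← prod.comp_lift] at h
  have sq : CommSq (R.factorThru _ h) e R.arrow (prod.lift x y) :=
    ⟨Subobject.factorThru_arrow _ _ h⟩
  unfold Mem
  rw [← sq.fac_right]
  exact Subobject.factors_comp_arrow _

theorem isReflexive_iff {X : C} {R : Rel X X} :
    IsReflexive R ↔ ∀ ⦃A : C⦄ (x : A ⟶ X), Mem x x R :=
  le_iff_forall_mem.trans
    ⟨fun h _ x => h x x (mem_idRel_iff.2 rfl), fun h _ x _ hxy => mem_idRel_iff.1 hxy ▸ h x⟩

theorem isSymmetric_iff {X : C} {R : Rel X X} :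
    IsSymmetric R ↔ ∀ ⦃A : C⦄ (x y : A ⟶ X), Mem x y R → Mem y x R :=
  le_iff_forall_mem.trans
    ⟨fun h _ x y hxy => h y x (mem_opp_iff.2 hxy), fun h _ x y hxy => h y x (mem_opp_iff.1 hxy)⟩

theorem isTransitive_iff {X : C} {R : Rel X X} :
    IsTransitive R ↔
      ∀ ⦃A : C⦄ (x y z : A ⟶ X), Mem x y R → Mem y z R → Mem x z R := by
  refine le_iff_forall_mem.trans
    ⟨fun h _ x y z hxy hyz => h x z (mem_comp hxy hyz), fun h A x z hxz => ?_⟩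
  obtain ⟨B, e, _, y, hxy, hyz⟩ := hxz.exists_of_comp
  exact Mem.of_precomp e (h _ _ _ hxy hyz)

/-- The inverse image of a relation along a pair of morphisms. -/
noncomputable def inverseImage {X Y X' Y' : C} (f : X' ⟶ X) (g : Y' ⟶ Y) (R : Rel X Y) :
    Rel X' Y' :=
  (Subobject.pullback (prod.map f g)).obj R

theorem mem_inverseImage_iff {X Y X' Y' A : C} {f : X' ⟶ X} {g : Y' ⟶ Y} {R : Rel X Y}
    {x : A ⟶ X'} {y : A ⟶ Y'} :
    Mem x y (inverseImage f g R) ↔ Mem (x ≫ f) (y ≫ g) R := by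
  unfold Mem inverseImage
  rw [pullback_factors_iff, prod.lift_map]

/-- The kernel pair of a morphism, as a relation. -/
noncomputable def kernelRel {X Y : C} (f : X ⟶ Y) : Rel X X := inverseImage f f (idRel Y)

theorem mem_kernelRel_iff {X Y A : C} {f : X ⟶ Y} {x y : A ⟶ X} :
    Mem x y (kernelRel f) ↔ x ≫ f = y ≫ f :=
  mem_inverseImage_iff.trans mem_idRel_iff

theorem isEquivalence_kernelRel {X Y : C} (f : X ⟶ Y) : IsEquivalence (kernelRel f) where
  refl := isReflexive_iff.2 fun _ _ => mem_kernelRel_iff.2 rfl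
  symm := isSymmetric_iff.2 fun _ _ _ h => mem_kernelRel_iff.2 (mem_kernelRel_iff.1 h).symm
  trans := isTransitive_iff.2 fun _ _ _ _ h h' =>
    mem_kernelRel_iff.2 ((mem_kernelRel_iff.1 h).trans (mem_kernelRel_iff.1 h'))

end Elements

/-! ### The Mal'tsev property and the Shifting Lemma. -/

section Maltsev

variable {C : Type u} [Category.{v} C] [Regular C]

/-- Reversing `x R y S z` gives `z S y R x`, and `comp S R`, being reflexive, is symmetric. -/
theorem IsMaltsev.mem_comp_swap (hC : IsMaltsev C) {X : C} {R S : Rel X X} (hR : IsReflexive R)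
    (hS : IsReflexive S) {A : C} {x z : A ⟶ X} (h : Mem x z (comp R S)) :
    Mem x z (comp S R) := by
  have hSR : IsReflexive (comp S R) :=
    isReflexive_iff.2 fun _ x => mem_comp (isReflexive_iff.1 hS x) (isReflexive_iff.1 hR x)
  obtain ⟨B, e, _, y, hxy, hyz⟩ := h.exists_of_comp
  refine Mem.of_precomp e (isSymmetric_iff.1 (hC _ hSR).symm _ _ (mem_comp (y := y) ?_ ?_))
  · exact isSymmetric_iff.1 (hC _ hS).symm _ _ hyz
  · exact isSymmetric_iff.1 (hC _ hR).symm _ _ hxy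

theorem IsMaltsev.shiftingLemma (hC : IsMaltsev C) {X : C} {R S T : Rel X X}
    (hR : IsReflexive R) (hS : IsReflexive S) (hT : IsReflexive T) : ShiftingLemma R S T := by
  intro hRST A x y u v hxy hxu hyv huv
  have hRT : IsReflexive (R ⊓ T) := le_inf hR hT
  have hR' := hC R hR
  have hS' := hC S hS
  have hT' := hC T hT
  have huy : Mem u y (comp S (R ⊓ T)) := mem_comp (isSymmetric_iff.1 hS'.symm _ _ hxu) hxy
  obtain ⟨B, e, _, w, huw, hwy⟩ := (hC.mem_comp_swap hS hRT huy).exists_of_comp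
  rw [mem_inf_iff] at huw
  have hwv : Mem w (e ≫ v) (R ⊓ S) := mem_inf_iff.2
    ⟨isTransitive_iff.1 hR'.trans _ _ _ (isSymmetric_iff.1 hR'.symm _ _ huw.1) (huv.precomp e),
      isTransitive_iff.1 hS'.trans _ _ _ hwy (hyv.precomp e)⟩
  exact Mem.of_precomp e (isTransitive_iff.1 hT'.trans _ _ _ huw.2 (hwv.mono hRST))

/-- The Shifting Lemma on the object `E`, for the relations `p₁ E q₂`, `p₁ = q₁` and `q₁ E p₂`
between elements `p` and `q` of `E`. -/
theorem mem_of_shiftingLemma {X : C} {E : Rel X X}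
    (h : ∀ R T : Rel (E : C) (E : C), IsReflexive R → IsReflexive T →
      ShiftingLemma R (kernelRel (leg₁ E)) T)
    {A : C} {a b c d p q : A ⟶ X} (hab : Mem a b E) (hcd : Mem c d E) (had : Mem a d E)
    (hap : Mem a p E) (hcq : Mem c q E) (haq : Mem a q E) (hcp : Mem c p E) : Mem c b E := by
  let R : Rel (E : C) (E : C) := inverseImage (leg₁ E) (leg₂ E) E
  let T : Rel (E : C) (E : C) := opp (inverseImage (leg₁ E) (leg₂ E) E)
  have hE : IsReflexive (inverseImage (leg₁ E) (leg₂ E) E) :=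
    isReflexive_iff.2 fun _ x => mem_inverseImage_iff.2 ((mem_legs E).precomp x)
  have hT : IsReflexive T := isReflexive_iff.2 fun _ x => mem_opp_iff.2 (isReflexive_iff.1 hE x)
  have hST : R ⊓ kernelRel (leg₁ E) ≤ T := by
    -- The kernel pair alone lies in `T`: if `x₁ = y₁`, then `y₁ = x₁ E x₂`.
    refine inf_le_right.trans (le_iff_forall_mem.2 fun A x y hxy => ?_)
    refine mem_opp_iff.2 (mem_inverseImage_iff.2 ?_)
    rw [← mem_kernelRel_iff.1 hxy]
    exact (mem_legs E).precomp x
  obtain ⟨ab, rfl, rfl⟩ := hab.exists_hom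
  obtain ⟨cd, rfl, rfl⟩ := hcd.exists_hom
  obtain ⟨ap, hap₁, rfl⟩ := hap.exists_hom
  obtain ⟨cq, hcq₁, rfl⟩ := hcq.exists_hom
  -- The corners are the pairs `(a, p)`, `(c, q)`, `(a, b)`, `(c, d)`; sharing a first component
  -- gives the two kernel pair edges.
  refine mem_inverseImage_iff.1 (mem_opp_iff.1 (h R T hE hT hST ap cq ab cd
    (mem_inf_iff.2 ⟨mem_inverseImage_iff.2 ?_, mem_opp_iff.2 (mem_inverseImage_iff.2 ?_)⟩)
    (mem_kernelRel_iff.2 hap₁) (mem_kernelRel_iff.2 hcq₁) (mem_inverseImage_iff.2 had)))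
  · rwa [hap₁]
  · rwa [hcq₁]

theorem isEquivalence_of_shiftingLemma {X : C} {E : Rel X X} (hE : IsReflexive E)
    (h : ∀ R T : Rel (E : C) (E : C), IsReflexive R → IsReflexive T →
      ShiftingLemma R (kernelRel (leg₁ E)) T) : IsEquivalence E where
  refl := hE
  symm := isSymmetric_iff.2 fun _ x y hxy =>
    have hx := isReflexive_iff.1 hE x
    have hy := isReflexive_iff.1 hE y
    -- Here `a = b = x` and `c = d = p = q = y`.
    mem_of_shiftingLemma h hx hy hxy hxy hy hxy hy
  trans := isTransitive_iff.2 fun _ _ y _ hxy hyz =>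
    have hy := isReflexive_iff.1 hE y
    -- For `x E y E z`: `c = x`, `b = z` and `a = d = p = q = y`.
    mem_of_shiftingLemma h hyz hxy hy hy hxy hy hxy

end Maltsev

end InternalRelation

theorem corollary2p3 {C : Type u} [Category.{v} C] [Regular C] :
    InternalRelation.IsMaltsev C ↔
      ∀ (X : C) (R S T : InternalRelation.Rel X X),
        InternalRelation.IsReflexive R → InternalRelation.IsEquivalence S →
          InternalRelation.IsReflexive T → InternalRelation.ShiftingLemma R S T :=
  ⟨fun hC _ _ _ _ hR hS hT => hC.shiftingLemma hR hS.refl hT,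
    fun h _ _ hE => InternalRelation.isEquivalence_of_shiftingLemma hE fun R T hR hT =>
      h _ R _ T hR (InternalRelation.isEquivalence_kernelRel _) hT⟩
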